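/- A topological space $X$ is a cut-point space if it is (nonempty and) connected and $X\setminus\{x\}$ is disconnected for every $x\in X$. A continuum is a (nonempty) connected compact Hausdorff space. A Hausdorff arc is a continuum whose topology is the order topology of some linear order. A space is weakly orderable if it admits a continuous injection into a Hausdorff arc. A continuum $K$ is irreducible if there are two distinct points $a,b\in K$ such that no proper subcontinuum of $K$ contains both $a$ and $b$. Let $X$ be a Tychonoff cut-point space. Then $X$ is weakly orderable if and only if its Stone–Čech compactification $\beta X$ is an irreducible continuum. -/

import Mathlib

universe u

/-- A point `x` is a cut point of `X` if `X \ {x}` is disconnected, i.e. is the union of two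
disjoint nonempty (relatively) open sets.  The empty set is not disconnected. -/
def IsCutPoint {X : Type u} [TopologicalSpace X] (x : X) : Prop :=
  ¬ IsPreconnected ({x}ᶜ : Set X)

/-- A cut-point space: a (nonempty) connected space in which every point is a cut point. -/
structure IsCutPointSpace (X : Type u) [TopologicalSpace X] : Prop where
  connected : ConnectedSpace X
  cut : ∀ x : X, IsCutPoint x

/-- A continuum: a (nonempty) connected compact Hausdorff space. -/
structure IsContinuum (X : Type u) [TopologicalSpace X] : Prop where
  connected : ConnectedSpace X
  compact : CompactSpace X
  hausdorff : T2Space X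

/-- A subcontinuum of `X`: a subset which is a continuum in the subspace topology. -/
def IsSubcontinuum {X : Type u} [TopologicalSpace X] (K : Set X) : Prop :=
  IsContinuum K

/-- `X` is irreducible between `a` and `b`: no proper subcontinuum contains both points. -/
def IrreducibleBetween (X : Type u) [TopologicalSpace X] (a b : X) : Prop :=
  ∀ K : Set X, IsSubcontinuum K → a ∈ K → b ∈ K → K = Set.univ

/-- An irreducible continuum: a continuum irreducible between some two of its points. -/
def IsIrreducibleContinuum (X : Type u) [TopologicalSpace X] : Prop :=
  IsContinuum X ∧ ∃ a b : X, a ≠ b ∧ IrreducibleBetween X a b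

/-- A Hausdorff arc: a continuum whose topology is the order topology of a linear order. -/
def IsHausdorffArc (Y : Type u) [TopologicalSpace Y] : Prop :=
  IsContinuum Y ∧ ∃ _ : LinearOrder Y, OrderTopology Y

/-- `X` is weakly orderable: some continuous injection maps `X` into a Hausdorff arc.
(For connected `X` the closure of the image is an arc with at most two more points than `X`,
so it is no restriction to take the arc in the universe of `X`.) -/
def WeaklyOrderable (X : Type u) [TopologicalSpace X] : Prop :=
  ∃ (Y : Type u) (_ : TopologicalSpace Y), IsHausdorffArc Y ∧
    ∃ f : X → Y, Continuous f ∧ Function.Injective f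

/-! A cut point `x` of `X` also cuts `StoneCech X`: collapsing one side to `x` is continuous and
extends to the compactification, so the closures of the two sides cover it and meet only at `x`. If
`X` injects into an arc, the pulled-back rays are such sides. By compactness the closures of all
lower rays share a point `a`, those of all upper rays a point `b`. A subcontinuum through both meets
every `x`, hence is everything by density. Conversely, irreducibility between `a` and `b` puts them
on opposite sides of each `x`. The sides towards `a` are nested and become the open lower rays of a
linear order, whose completion is the arc. -/

open Set

/-- A separation of `{x}ᶜ` into two nonempty disjoint open sets. -/
structure IsPointSeparation {X : Type u} [TopologicalSpace X] (x : X) (A B : Set X) : Prop where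
  isOpen_left : IsOpen A
  isOpen_right : IsOpen B
  disjoint : Disjoint A B
  union_eq : A ∪ B = {x}ᶜ
  left_nonempty : A.Nonempty
  right_nonempty : B.Nonempty

/-- The closure in `StoneCech X` of the image of a subset of `X`. -/
def stoneCechClosure {X : Type u} [TopologicalSpace X] (S : Set X) : Set (StoneCech X) :=
  closure (stoneCechUnit '' S)

section Separation

variable {X : Type u} [TopologicalSpace X] {x : X} {A B : Set X}

theorem IsCutPoint.exists_isPointSeparation [T1Space X] (h : IsCutPoint x) :
    ∃ A B : Set X, IsPointSeparation x A B := by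
  have ho : IsOpen ({x}ᶜ : Set X) := isOpen_compl_singleton
  simp only [IsCutPoint, IsPreconnected, not_forall] at h
  obtain ⟨u, v, hu, hv, hs, hnu, hnv, hd⟩ := h
  refine ⟨{x}ᶜ ∩ u, {x}ᶜ ∩ v, ho.inter hu, ho.inter hv, ?_, ?_, hnu, hnv⟩
  · rw [disjoint_iff_inter_eq_empty, ← inter_inter_distrib_left]
    exact not_nonempty_iff_eq_empty.mp hd
  · rw [← inter_union_distrib_left]
    exact inter_eq_left.mpr hs

namespace IsPointSeparation

theorem symm (h : IsPointSeparation x A B) : IsPointSeparation x B A :=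
  ⟨h.isOpen_right, h.isOpen_left, h.disjoint.symm, by rw [union_comm, h.union_eq],
    h.right_nonempty, h.left_nonempty⟩

theorem notMem_left (h : IsPointSeparation x A B) : x ∉ A := fun hx => by
  have : x ∈ ({x}ᶜ : Set X) := h.union_eq ▸ Or.inl hx
  exact this rfl

theorem mem_or_mem (h : IsPointSeparation x A B) {y : X} (hy : y ≠ x) : y ∈ A ∨ y ∈ B := by
  have : y ∈ A ∪ B := h.union_eq ▸ hy
  exact this

theorem insert_left_eq (h : IsPointSeparation x A B) : insert x A = Bᶜ := by
  ext y
  rw [mem_insert_iff, mem_compl_iff]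
  constructor
  · rintro (rfl | hy)
    · exact h.symm.notMem_left
    · exact disjoint_left.mp h.disjoint hy
  · intro hy
    by_cases hyx : y = x
    · exact Or.inl hyx
    · exact Or.inr ((h.mem_or_mem hyx).resolve_right hy)

theorem isClosed_insert_left (h : IsPointSeparation x A B) : IsClosed (insert x A) := by
  rw [h.insert_left_eq]
  exact h.isOpen_right.isClosed_compl

theorem insert_union_insert (h : IsPointSeparation x A B) : insert x A ∪ insert x B = univ := by
  refine eq_univ_of_forall fun y => ?_
  by_cases hyx : y = x
  · exact Or.inl (Or.inl hyx)
  · exact (h.mem_or_mem hyx).imp Or.inr Or.inr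

/-- Collapsing one side of a separation to the separating point is a retraction. -/
theorem exists_retraction (h : IsPointSeparation x A B) :
    ∃ r : X → X, Continuous r ∧ (∀ y ∈ insert x A, r y = y) ∧ ∀ y ∈ insert x B, r y = x := by
  classical
  have hA : ∀ y ∈ insert x A, (if y ∈ B then x else y) = y := fun y hy =>
    if_neg (by rwa [h.insert_left_eq] at hy)
  have hB : ∀ y ∈ insert x B, (if y ∈ B then x else y) = x := fun y hy => by
    rcases hy with rfl | hy
    · exact ite_self _
    · exact if_pos hy
  refine ⟨fun y => if y ∈ B then x else y, ?_, hA, hB⟩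
  rw [← continuousOn_univ, ← h.insert_union_insert]
  exact (continuousOn_id.congr hA).union_of_isClosed (continuousOn_const.congr hB)
    h.isClosed_insert_left h.symm.isClosed_insert_left

theorem isPreconnected_insert_left [PreconnectedSpace X] (h : IsPointSeparation x A B) :
    IsPreconnected (insert x A) := by
  obtain ⟨r, hr, hA, hB⟩ := h.exists_retraction
  have : insert x A = r '' univ := by
    refine Subset.antisymm (fun y hy => ⟨y, mem_univ _, hA y hy⟩) ?_
    rintro _ ⟨y, -, rfl⟩
    rcases h.insert_union_insert.ge (mem_univ y) with hy | hy
    · rwa [hA y hy]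
    · rw [hB y hy]
      exact mem_insert _ _
  rw [this]
  exact isPreconnected_univ.image r hr.continuousOn

theorem stoneCechClosure_union (h : IsPointSeparation x A B) :
    stoneCechClosure (insert x A) ∪ stoneCechClosure (insert x B) = univ := by
  rw [stoneCechClosure, stoneCechClosure, ← closure_union, ← image_union,
    h.insert_union_insert, image_univ]
  exact denseRange_stoneCechUnit.closure_range

/-- The extended collapse is the identity on one closure and constantly `x` on the other. -/
theorem eq_of_mem_stoneCechClosure [T35Space X] (h : IsPointSeparation x A B) {z : StoneCech X}
    (hA : z ∈ stoneCechClosure (insert x A)) (hB : z ∈ stoneCechClosure (insert x B)) :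
    z = stoneCechUnit x := by
  obtain ⟨r, hr, hrA, hrB⟩ := h.exists_retraction
  have hg : Continuous (stoneCechUnit ∘ r) := continuous_stoneCechUnit.comp hr
  have hc := continuous_stoneCechExtend hg
  have h1 : stoneCechExtend hg z = z := by
    refine closure_minimal ?_ (isClosed_eq hc continuous_id) hA
    rintro _ ⟨y, hy, rfl⟩
    change stoneCechExtend hg (stoneCechUnit y) = stoneCechUnit y
    rw [stoneCechExtend_stoneCechUnit, Function.comp_apply, hrA y hy]
  have h2 : stoneCechExtend hg z = stoneCechUnit x := by
    refine closure_minimal ?_ (isClosed_eq hc continuous_const) hB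
    rintro _ ⟨y, hy, rfl⟩
    change stoneCechExtend hg (stoneCechUnit y) = stoneCechUnit x
    rw [stoneCechExtend_stoneCechUnit, Function.comp_apply, hrB y hy]
  exact h1.symm.trans h2

end IsPointSeparation

theorem isClosed_stoneCechClosure (S : Set X) : IsClosed (stoneCechClosure S) :=
  isClosed_closure

theorem stoneCechClosure_mono {S T : Set X} (h : S ⊆ T) :
    stoneCechClosure S ⊆ stoneCechClosure T :=
  closure_mono (image_mono h)

theorem stoneCechUnit_mem_stoneCechClosure {S : Set X} {y : X} (hy : y ∈ S) :
    stoneCechUnit y ∈ stoneCechClosure S :=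
  subset_closure (mem_image_of_mem _ hy)

theorem mem_of_stoneCechUnit_mem_stoneCechClosure [T35Space X] {S : Set X} (hS : IsClosed S)
    {y : X} (hy : stoneCechUnit y ∈ stoneCechClosure S) : y ∈ S := by
  have : y ∈ closure S := by
    rw [isInducing_stoneCechUnit.closure_eq_preimage_closure_image]
    exact hy
  rwa [hS.closure_eq] at this

theorem isContinuum_stoneCech [ConnectedSpace X] : IsContinuum (StoneCech X) := by
  refine ⟨?_, inferInstance, inferInstance⟩
  have : PreconnectedSpace (StoneCech X) :=
    denseRange_stoneCechUnit.preconnectedSpace continuous_stoneCechUnit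
  exact { toNonempty := (inferInstance : Nonempty X).map stoneCechUnit }

theorem isSubcontinuum_stoneCechClosure {S : Set X} (hS : IsPreconnected S) (hne : S.Nonempty) :
    IsSubcontinuum (stoneCechClosure S) := by
  refine ⟨?_, isCompact_iff_compactSpace.mp (isClosed_stoneCechClosure S).isCompact,
    inferInstance⟩
  exact isConnected_iff_connectedSpace.mp
    (IsConnected.closure ⟨hne.image _, hS.image _ continuous_stoneCechUnit.continuousOn⟩)

end Separation

/-- If every point separates its open lower ray from its open upper ray, then the Stone–Čech
compactification is irreducible, between a point at the lower end and one at the upper end. -/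
theorem isIrreducibleContinuum_stoneCech {X : Type u} [TopologicalSpace X] [T35Space X]
    [ConnectedSpace X] [LinearOrder X] (h : ∀ x : X, IsPointSeparation x (Iio x) (Ioi x)) :
    IsIrreducibleContinuum (StoneCech X) := by
  have hI (x : X) : insert x (Iio x) = Iic x := Iio_insert
  have hJ (x : X) : insert x (Ioi x) = Ici x := Ioi_insert
  have hcI (x : X) : IsClosed (Iic x) := hI x ▸ (h x).isClosed_insert_left
  have hcJ (x : X) : IsClosed (Ici x) := hJ x ▸ (h x).symm.isClosed_insert_left
  obtain ⟨a, ha⟩ : (⋂ x : X, stoneCechClosure (Iic x)).Nonempty := by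
    refine IsCompact.nonempty_iInter_of_directed_nonempty_isCompact_isClosed _ ?_
      (fun x => ⟨_, stoneCechUnit_mem_stoneCechClosure self_mem_Iic⟩)
      (fun x => (isClosed_stoneCechClosure _).isCompact) (fun x => isClosed_stoneCechClosure _)
    exact fun x y => ⟨min x y, stoneCechClosure_mono (Iic_subset_Iic.mpr (min_le_left x y)),
      stoneCechClosure_mono (Iic_subset_Iic.mpr (min_le_right x y))⟩
  obtain ⟨b, hb⟩ : (⋂ x : X, stoneCechClosure (Ici x)).Nonempty := by
    refine IsCompact.nonempty_iInter_of_directed_nonempty_isCompact_isClosed _ ?_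
      (fun x => ⟨_, stoneCechUnit_mem_stoneCechClosure self_mem_Ici⟩)
      (fun x => (isClosed_stoneCechClosure _).isCompact) (fun x => isClosed_stoneCechClosure _)
    exact fun x y => ⟨max x y, stoneCechClosure_mono (Ici_subset_Ici.mpr (le_max_left x y)),
      stoneCechClosure_mono (Ici_subset_Ici.mpr (le_max_right x y))⟩
  rw [mem_iInter] at ha hb
  have hinter (x : X) {z : StoneCech X} (hz : z ∈ stoneCechClosure (Iic x))
      (hz' : z ∈ stoneCechClosure (Ici x)) : z = stoneCechUnit x :=
    (h x).eq_of_mem_stoneCechClosure (by rwa [hI]) (by rwa [hJ])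
  have hax (x : X) : a ≠ stoneCechUnit x := by
    rintro rfl
    obtain ⟨y, hy⟩ := (h x).left_nonempty
    exact not_le_of_gt hy (mem_of_stoneCechUnit_mem_stoneCechClosure (hcI y) (ha y))
  have hbx (x : X) : b ≠ stoneCechUnit x := by
    rintro rfl
    obtain ⟨y, hy⟩ := (h x).right_nonempty
    exact not_le_of_gt hy (mem_of_stoneCechUnit_mem_stoneCechClosure (hcJ y) (hb y))
  refine ⟨isContinuum_stoneCech, a, b, ?_, ?_⟩
  · rintro rfl
    obtain ⟨x⟩ := (inferInstance : Nonempty X)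
    exact hax x (hinter x (ha x) (hb x))
  · intro K hK haK hbK
    have hKc : IsClosed K := (isCompact_iff_compactSpace.mpr hK.compact).isClosed
    have hKp : IsPreconnected K := (isConnected_iff_connectedSpace.mpr hK.connected).isPreconnected
    have hmem (x : X) : stoneCechUnit x ∈ K := by
      -- A connected `K` meeting both closed pieces meets their intersection, which is just `x`.
      obtain ⟨z, hzK, hz, hz'⟩ := isPreconnected_closed_iff.mp hKp _ _
        (isClosed_stoneCechClosure (Iic x)) (isClosed_stoneCechClosure (Ici x))
        (by rw [← hI, ← hJ, (h x).stoneCechClosure_union]; exact subset_univ K)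
        ⟨a, haK, ha x⟩ ⟨b, hbK, hb x⟩
      rwa [← hinter x hz hz']
    refine univ_subset_iff.mp ?_
    rw [← denseRange_stoneCechUnit.closure_range]
    exact closure_minimal (range_subset_iff.mpr hmem) hKc

/-- A continuous injection of a connected space into a linear order does not attain its minimum at
a cut point. -/
theorem exists_lt_of_continuous_injective {X Y : Type*} [TopologicalSpace X] [PreconnectedSpace X]
    [TopologicalSpace Y] [LinearOrder Y] [OrderTopology Y] {f : X → Y} (hf : Continuous f)
    (hinj : Function.Injective f) {x : X} {A B : Set X} (h : IsPointSeparation x A B) :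
    ∃ y, f y < f x := by
  by_contra! hmin
  obtain ⟨p, hp⟩ := h.left_nonempty
  obtain ⟨q, hq⟩ := h.right_nonempty
  wlog hpq : f p ≤ f q generalizing A B p q
  · exact this h.symm q hq p hp (le_of_not_ge hpq)
  have hc : IsPreconnected (f '' insert x B) :=
    h.symm.isPreconnected_insert_left.image f hf.continuousOn
  -- `f p` lies between `f x` and `f q`, so the side containing `q` also attains it.
  obtain ⟨y, hy, hyp⟩ := hc.Icc_subset (mem_image_of_mem f (mem_insert x B))
    (mem_image_of_mem f (mem_insert_of_mem x hq)) ⟨hmin p, hpq⟩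
  obtain rfl := hinj hyp
  rw [h.symm.insert_left_eq] at hy
  exact hy hp

/-- The linear order pulled back along a continuous injection into an arc has the property that every
cut point separates its open lower ray from its open upper ray. -/
theorem WeaklyOrderable.isIrreducibleContinuum_stoneCech {X : Type u} [TopologicalSpace X]
    [T35Space X] (hX : IsCutPointSpace X) (h : WeaklyOrderable X) :
    IsIrreducibleContinuum (StoneCech X) := by
  obtain ⟨Y, _, ⟨-, _, _⟩, f, hf, hinj⟩ := h
  have := hX.connected
  let _ : LinearOrder X := LinearOrder.lift' f hinj
  refine _root_.isIrreducibleContinuum_stoneCech fun x => ?_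
  obtain ⟨A, B, hAB⟩ := (hX.cut x).exists_isPointSeparation
  refine ⟨isOpen_Iio.preimage hf, isOpen_Ioi.preimage hf, ?_, Iio_union_Ioi, ?_, ?_⟩
  · exact disjoint_left.mpr fun y hy hy' => lt_asymm hy hy'
  · exact exists_lt_of_continuous_injective hf hinj hAB
  · exact exists_lt_of_continuous_injective (Y := Yᵒᵈ) hf hinj hAB

/-- A connected space with a linear order all of whose open rays are open is weakly orderable:
it maps continuously into its Dedekind–MacNeille completion. -/
theorem weaklyOrderable_of_isOpen_rays {X : Type u} [TopologicalSpace X] [ConnectedSpace X]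
    [LinearOrder X] (hI : ∀ x : X, IsOpen (Iio x)) (hJ : ∀ x : X, IsOpen (Ioi x)) :
    WeaklyOrderable X := by
  -- Density passes to the completion and makes it connected.
  have : DenselyOrdered X := by
    refine ⟨fun a b hab => ?_⟩
    obtain ⟨c, -, hcb, hac⟩ := isPreconnected_univ (α := X) (Iio b) (Ioi a) (hI b) (hJ a)
      (fun c _ => (lt_or_ge c b).imp_right fun hbc => hab.trans_le hbc)
      ⟨a, mem_univ a, hab⟩ ⟨b, mem_univ b, hab⟩
    exact ⟨c, hac, hcb⟩
  let _ : TopologicalSpace (DedekindCut X) := Preorder.topology _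
  have : OrderTopology (DedekindCut X) := ⟨rfl⟩
  refine ⟨DedekindCut X, inferInstance, ⟨⟨?_, ?_, inferInstance⟩, inferInstance, inferInstance⟩,
    DedekindCut.principal, ?_, fun x y => DedekindCut.principal_inj.mp⟩
  · exact { toNonempty := ⟨⊥⟩ }
  · exact ⟨by simpa using isCompact_Icc (a := (⊥ : DedekindCut X)) (b := ⊤)⟩
  · refine continuous_generateFrom_iff.mpr ?_
    rintro s ⟨c, rfl | rfl⟩
    · have : DedekindCut.principal ⁻¹' Ioi c = ⋃ y ∈ c.right, Ioi y := by
        ext x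
        simp [DedekindCut.lt_principal_iff]
      rw [this]
      exact isOpen_biUnion fun y _ => hJ y
    · have : DedekindCut.principal ⁻¹' Iio c = ⋃ y ∈ c.left, Iio y := by
        ext x
        simp [DedekindCut.principal_lt_iff]
      rw [this]
      exact isOpen_biUnion fun y _ => hI y

/-! ### From irreducibility to a linear order -/

theorem IrreducibleBetween.exists_isPointSeparation {X : Type u} [TopologicalSpace X] [T35Space X]
    (hX : IsCutPointSpace X) {a b : StoneCech X} (hab : IrreducibleBetween (StoneCech X) a b)
    (x : X) : ∃ A B : Set X, IsPointSeparation x A B ∧ a ∈ stoneCechClosure (insert x A) ∧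
      b ∈ stoneCechClosure (insert x B) ∧ a ≠ stoneCechUnit x ∧ b ≠ stoneCechUnit x := by
  have := hX.connected
  -- The closure of a side is a proper subcontinuum, as it misses the other side's points of `X`.
  have key {A B : Set X} (h : IsPointSeparation x A B)
      (ha : a ∈ stoneCechClosure (insert x A)) : b ∉ stoneCechClosure (insert x A) := fun hb => by
    obtain ⟨y, hy⟩ := h.right_nonempty
    have huniv := hab _ (isSubcontinuum_stoneCechClosure h.isPreconnected_insert_left
      (insert_nonempty x A)) ha hb
    have hy' := mem_of_stoneCechUnit_mem_stoneCechClosure h.isClosed_insert_left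
      (huniv ▸ mem_univ (stoneCechUnit y))
    rw [h.insert_left_eq] at hy'
    exact hy' hy
  obtain ⟨A, B, h⟩ := (hX.cut x).exists_isPointSeparation
  wlog ha : a ∈ stoneCechClosure (insert x A) generalizing A B
  · exact this B A h.symm ((h.stoneCechClosure_union.ge (mem_univ a)).resolve_left ha)
  have hbA := key h ha
  have hb := (h.stoneCechClosure_union.ge (mem_univ b)).resolve_left hbA
  refine ⟨A, B, h, ha, hb, ?_, ?_⟩
  · rintro rfl
    exact key h.symm (stoneCechUnit_mem_stoneCechClosure (mem_insert x B)) hb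
  · rintro rfl
    exact hbA (stoneCechUnit_mem_stoneCechClosure (mem_insert x A))

/-- The sides containing a fixed point at infinity are nested. -/
theorem IsPointSeparation.insert_subset {X : Type u} [TopologicalSpace X] [T35Space X]
    [PreconnectedSpace X] {x y : X} {A B C D : Set X} (h : IsPointSeparation x A B)
    (h' : IsPointSeparation y C D) {a : StoneCech X} (ha : a ∈ stoneCechClosure (insert x A))
    (ha' : a ∈ stoneCechClosure (insert y C)) (hay : a ≠ stoneCechUnit y) (hy : y ∈ B) :
    insert x A ⊆ C := by
  have hsub : insert x A ⊆ C ∪ D := by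
    rw [h'.union_eq, h.insert_left_eq, compl_subset_compl, singleton_subset_iff]
    exact hy
  -- The connected side avoids `y`. Lying in `D` would put `a` in both closures at `y`, forcing `a`
  -- to be `y`.
  rcases h.isPreconnected_insert_left.subset_or_subset h'.isOpen_left h'.isOpen_right
    h'.disjoint hsub with hC | hD
  · exact hC
  · exact absurd (h'.eq_of_mem_stoneCechClosure ha'
      (stoneCechClosure_mono (hD.trans (subset_insert y D)) ha)) hay

theorem IsIrreducibleContinuum.weaklyOrderable {X : Type u} [TopologicalSpace X] [T35Space X]
    (hX : IsCutPointSpace X) (h : IsIrreducibleContinuum (StoneCech X)) : WeaklyOrderable X := by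
  classical
  have := hX.connected
  obtain ⟨-, a, b, -, hab⟩ := h
  choose A B hAB ha hb hax hbx using hab.exists_isPointSeparation hX
  have hA {x y : X} (hy : y ∈ B x) : insert x (A x) ⊆ A y :=
    (hAB x).insert_subset (hAB y) (ha x) (ha y) (hax y) hy
  have hB {x y : X} (hy : y ∈ A x) : insert x (B x) ⊆ B y :=
    (hAB x).symm.insert_subset (hAB y).symm (hb x) (hb y) (hbx y) hy
  have hiff {x y : X} : x ∈ A y ↔ y ∈ B x :=
    ⟨fun hx => hB hx (mem_insert _ _), fun hy => hA hy (mem_insert _ _)⟩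
  -- `x` precedes `y` when it lies on the `a`-side of `y`.
  have : IsStrictTotalOrder X (fun x y => x ∈ A y) :=
    { irrefl := fun x => (hAB x).notMem_left
      trans := fun x y z hxy hyz => hA (hiff.mp hyz) (mem_insert_of_mem y hxy)
      trichotomous := fun x y hxy hyx => by
        by_contra hne
        exact ((hAB y).mem_or_mem hne).elim hxy fun hx => hyx (hiff.mpr hx) }
  let _ : LinearOrder X := linearOrderOfSTO (fun x y => x ∈ A y)
  refine weaklyOrderable_of_isOpen_rays (fun x => (hAB x).isOpen_left) fun x => ?_
  have : Ioi x = B x := ext fun y => hiff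
  rw [this]
  exact (hAB x).isOpen_right

theorem corollary3p6 (X : Type u) [TopologicalSpace X] [T35Space X] (hX : IsCutPointSpace X) :
    WeaklyOrderable X ↔ IsIrreducibleContinuum (StoneCech X) :=
  ⟨fun h => h.isIrreducibleContinuum_stoneCech hX, fun h => h.weaklyOrderable hX⟩
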